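/- All algebras are finite-dimensional over a field $F$ of characteristic zero. A Leibniz algebra is a vector space $L$ with a bilinear bracket satisfying $[x,[y,z]]=[[x,y],z]-[[x,z],y]$ for all $x,y,z\in L$. For two-sided ideals $H,K$ let $[H,K]$ be the span of all $[h,k]$ and $[k,h]$ with $h\in H$, $k\in K$; put $L^1=L^{[1]}=L$, $L^{k+1}=[L^k,L]$ and $L^{[s+1]}=[L^{[s]},L^{[s]}]$. The algebra $L$ is nilpotent if $L^k=0$ for some $k$, and solvable if $L^{[s]}=0$ for some $s$; its nilradical is its maximal nilpotent two-sided ideal. Let $NF_n$ be the algebra with basis $\{e_1,\dots,e_n\}$ whose only nonzero products of basis elements are $[e_i,e_1]=e_{i+1}$ for $1\le i\le n-1$. **Theorem.** Let $n\ge 2$ and let $R$ be a non-nilpotent solvable Leibniz algebra over $F$ whose nilradical is isomorphic to $NF_n$. Then $R$ has a basis $\{e_1,\dots,e_n,x\}$ in which the only nonzero products of basis elements are $$[e_i,e_1]=e_{i+1}\ (1\le i\le n-1),\qquad [x,e_1]=e_1,\qquad [e_i,x]=-i\,e_i\ (1\le i\le n).$$ Consequently $R$ is unique up to isomorphism: any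 two non-nilpotent solvable Leibniz algebras over $F$ whose nilradicals are isomorphic to $NF_n$ (same $n\ge 2$) are isomorphic. -/

import Mathlib

/-!
Leibniz algebras. An algebra over a field `F` is a (not necessarily unital or associative) ring `L`
which is an `F`-module with bilinear multiplication; the product `x * y` is the bracket `[x, y]`.
-/

namespace Leibniz

/-- The (right) Leibniz identity `[x, [y, z]] = [[x, y], z] - [[x, z], y]`. -/
class IsLeibniz (L : Type*) [NonUnitalNonAssocRing L] : Prop where
  leibniz : ∀ x y z : L, x * (y * z) = (x * y) * z - (x * z) * y

section

variable {F L : Type*} [Field F] [NonUnitalNonAssocRing L] [Module F L]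

/-- `H` is a two-sided ideal: `[L, H] ⊆ H` and `[H, L] ⊆ H`. -/
def IsIdeal (H : Submodule F L) : Prop :=
  ∀ x : L, ∀ h ∈ H, x * h ∈ H ∧ h * x ∈ H

/-- `[H, K]`: the span of the brackets `[h, k]` and `[k, h]` with `h ∈ H` and `k ∈ K`. -/
def commutator (H K : Submodule F L) : Submodule F L :=
  Submodule.span F {z | ∃ h ∈ H, ∃ k ∈ K, z = h * k ∨ z = k * h}

/-- The lower central series of `H` as an algebra in its own right, indexed from `0`:
`lowerCentral H k` is `H^(k+1)`, where `H^1 = H` and `H^(k+1) = [H^k, H]`. -/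
def lowerCentral (H : Submodule F L) : ℕ → Submodule F L
  | 0 => H
  | k + 1 => commutator (lowerCentral H k) H

/-- The derived series of `H` as an algebra in its own right, indexed from `0`:
`derived H s` is `H^[s+1]`, where `H^[1] = H` and `H^[s+1] = [H^[s], H^[s]]`. -/
def derived (H : Submodule F L) : ℕ → Submodule F L
  | 0 => H
  | s + 1 => commutator (derived H s) (derived H s)

/-- `H` (an ideal, or `⊤` for the whole algebra) is a nilpotent algebra. -/
def IsNilpotent (H : Submodule F L) : Prop := ∃ k, lowerCentral H k = ⊥

/-- `H` (an ideal, or `⊤` for the whole algebra) is a solvable algebra. -/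
def IsSolvable (H : Submodule F L) : Prop := ∃ s, derived H s = ⊥

/-- `N` is the nilradical: a nilpotent two-sided ideal, maximal among these. -/
def IsNilradical (N : Submodule F L) : Prop :=
  Maximal (fun I : Submodule F L => IsIdeal I ∧ IsNilpotent I) N

end

/-- The products of `e_1, …, e_n` (here `e i` stands for `e_(i+1)`) are those of `NF_n`:
`[e_i, e_1] = e_(i+1)` for `1 ≤ i ≤ n - 1`, all others zero. -/
def HasNFTable {L : Type*} [NonUnitalNonAssocRing L] {n : ℕ} (e : Fin n → L) : Prop :=
  ∀ i j : Fin n, e i * e j =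
    if h : (j : ℕ) = 0 ∧ (i : ℕ) + 1 < n then e ⟨(i : ℕ) + 1, h.2⟩ else 0

/-- The subspace `N` with the products of `L` is the algebra `NF_n`: it has a basis
`e_1, …, e_n` with the multiplication table of `NF_n`. -/
def IsNF {F L : Type*} [Field F] [NonUnitalNonAssocRing L] [Module F L]
    (n : ℕ) (N : Submodule F L) : Prop :=
  ∃ e : Module.Basis (Fin n) F N, HasNFTable (fun i => (e i : L))

/-- The multiplication table of `e_1, …, e_n, x` (here `e i` stands for `e_(i+1)`):
`[e_i, e_1] = e_(i+1)` for `1 ≤ i ≤ n - 1`, `[x, e_1] = e_1`, `[e_i, x] = -i e_i` for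
`1 ≤ i ≤ n`, all others zero. -/
structure HasRTable (F : Type*) {L : Type*} [Field F] [NonUnitalNonAssocRing L] [Module F L]
    {n : ℕ} (e : Fin n → L) (x : L) : Prop where
  e_mul_e : HasNFTable e
  x_mul_e : ∀ j : Fin n, x * e j = if (j : ℕ) = 0 then e j else 0
  e_mul_x : ∀ i : Fin n, e i * x = -(((i : ℕ) : F) + 1) • e i
  x_mul_x : x * x = 0

end Leibniz

namespace Leibniz

section

variable {F L : Type*} [Field F] [NonUnitalNonAssocRing L] [Module F L]

/-! Filter the nilradical `N` by its tails. Right multiplication by any `p` is a derivation, hence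
triangular on `N` with diagonal `a, 2a, 3a, …`, where `a` is the coefficient of `E 0` in `E 0 * p`
(`mul_sub_mem`). The kernel `raising` of `p ↦ a` contains all products. Adding its intersections
with the derived series to `N`, from the last term upwards, always gives a nilpotent ideal, so
maximality yields `raising = N` (`raising_eq`). Hence `N` has codimension at most one, and exactly
one because `R` is not nilpotent. Normalise `x` to `a = -1`. In characteristic zero right
multiplication by `x` is invertible on `N`, so `x` can be corrected to have square zero
(`exists_sq_zero`). Then `u = x * E 0` satisfies `x * u = u` and `u * x = -u`, and its powers
together with `x` form the required basis. Uniqueness follows by comparing tables. -/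

theorem IsLeibniz.mul_mul_right [IsLeibniz L] (x y z : L) :
    (x * y) * z = x * (y * z) + (x * z) * y := by
  rw [IsLeibniz.leibniz x y z]; abel

/-! ### Null-filiform sequences and the filtration by tails. -/

/-- An infinite sequence with the products of the basis of a null-filiform algebra; it is allowed
to vanish from some index on. -/
structure IsNullFiliform (E : ℕ → L) : Prop where
  mul_zero : ∀ i, E i * E 0 = E (i + 1)
  mul_succ : ∀ i j, E i * E (j + 1) = 0

/-- The span of the terms of index at least `k`. -/
def tail (F : Type*) {L : Type*} [Field F] [NonUnitalNonAssocRing L] [Module F L]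
    (E : ℕ → L) (k : ℕ) : Submodule F L :=
  Submodule.span F (E '' Set.Ici k)

theorem mem_tail (E : ℕ → L) {i k : ℕ} (h : k ≤ i) : E i ∈ tail F E k :=
  Submodule.subset_span ⟨i, h, rfl⟩

theorem tail_anti (E : ℕ → L) {k l : ℕ} (h : k ≤ l) : tail F E l ≤ tail F E k :=
  Submodule.span_mono (Set.image_mono (Set.Ici_subset_Ici.mpr h))

theorem tail_le {E : ℕ → L} {k : ℕ} {P : Submodule F L} (h : ∀ i, k ≤ i → E i ∈ P) :
    tail F E k ≤ P := by
  refine Submodule.span_le.mpr ?_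
  rintro _ ⟨i, hi, rfl⟩
  exact h i hi

theorem tail_eq_bot {E : ℕ → L} {n : ℕ} (h : ∀ i, n ≤ i → E i = 0) : tail F E n = ⊥ :=
  le_bot_iff.mp (tail_le fun i hi => by simp [h i hi])

theorem exists_sub_mem_tail_succ (E : ℕ → L) {k : ℕ} {w : L} (hw : w ∈ tail F E k) :
    ∃ c : F, w - c • E k ∈ tail F E (k + 1) := by
  have h : tail F E k ≤ Submodule.span F {E k} ⊔ tail F E (k + 1) := by
    refine tail_le fun i hi => ?_
    rcases hi.eq_or_lt with rfl | hi
    · exact Submodule.mem_sup_left (Submodule.mem_span_singleton_self _)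
    · exact Submodule.mem_sup_right (mem_tail E hi)
  obtain ⟨y, hy, z, hz, rfl⟩ := Submodule.mem_sup.mp (h hw)
  obtain ⟨c, rfl⟩ := Submodule.mem_span_singleton.mp hy
  exact ⟨c, by simpa using hz⟩

theorem mul_mem_of_mem_tail [IsScalarTower F L L] {E : ℕ → L} {k : ℕ} {P : Submodule F L} {y : L}
    (h : ∀ i, k ≤ i → E i * y ∈ P) {w : L} (hw : w ∈ tail F E k) : w * y ∈ P :=
  (tail_le (P := P.comap (LinearMap.mulRight F y)) h) hw

theorem mul_mem_of_mem_tail' [SMulCommClass F L L] {E : ℕ → L} {k : ℕ} {P : Submodule F L} {y : L}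
    (h : ∀ i, k ≤ i → y * E i ∈ P) {w : L} (hw : w ∈ tail F E k) : y * w ∈ P :=
  (tail_le (P := P.comap (LinearMap.mulLeft F y)) h) hw

/-! ### Commutators and ideals. -/

theorem commutator_le {H K P : Submodule F L}
    (h : ∀ x ∈ H, ∀ y ∈ K, x * y ∈ P ∧ y * x ∈ P) : commutator H K ≤ P := by
  refine Submodule.span_le.mpr ?_
  rintro _ ⟨x, hx, y, hy, rfl | rfl⟩
  · exact (h x hx y hy).1
  · exact (h x hx y hy).2

theorem mul_mem_commutator {H K : Submodule F L} {x y : L} (hx : x ∈ H) (hy : y ∈ K) :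
    x * y ∈ commutator H K :=
  Submodule.subset_span ⟨x, hx, y, hy, Or.inl rfl⟩

theorem IsIdeal.commutator_self [IsScalarTower F L L] [SMulCommClass F L L] [IsLeibniz L]
    {H : Submodule F L} (hH : IsIdeal H) :
    IsIdeal (commutator H H) := by
  intro x
  have hl : commutator H H ≤ (commutator H H).comap (LinearMap.mulLeft F x) := by
    have key : ∀ y ∈ H, ∀ z ∈ H, x * (y * z) ∈ commutator H H := fun y hy z hz => by
      rw [IsLeibniz.leibniz]
      exact sub_mem (mul_mem_commutator (hH x y hy).1 hz) (mul_mem_commutator (hH x z hz).1 hy)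
    exact commutator_le fun y hy z hz => ⟨key y hy z hz, key z hz y hy⟩
  have hr : commutator H H ≤ (commutator H H).comap (LinearMap.mulRight F x) := by
    have key : ∀ y ∈ H, ∀ z ∈ H, y * z * x ∈ commutator H H := fun y hy z hz => by
      rw [IsLeibniz.mul_mul_right]
      exact add_mem (mul_mem_commutator hy (hH x z hz).2) (mul_mem_commutator (hH x y hy).2 hz)
    exact commutator_le fun y hy z hz => ⟨key y hy z hz, key z hz y hy⟩
  exact fun h hh => ⟨hl hh, hr hh⟩

theorem isIdeal_derived_top [IsScalarTower F L L] [SMulCommClass F L L] [IsLeibniz L] (s : ℕ) :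
    IsIdeal (derived (⊤ : Submodule F L) s) := by
  induction s with
  | zero => exact fun _ _ _ => ⟨trivial, trivial⟩
  | succ s ih => exact ih.commutator_self

theorem IsIdeal.sup {H K : Submodule F L} (hH : IsIdeal H) (hK : IsIdeal K) :
    IsIdeal (H ⊔ K) := by
  intro x w hw
  obtain ⟨y, hy, z, hz, rfl⟩ := Submodule.mem_sup.mp hw
  rw [mul_add, add_mul]
  exact ⟨add_mem (Submodule.mem_sup_left (hH x y hy).1) (Submodule.mem_sup_right (hK x z hz).1),
    add_mem (Submodule.mem_sup_left (hH x y hy).2) (Submodule.mem_sup_right (hK x z hz).2)⟩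

theorem IsIdeal.inf {H K : Submodule F L} (hH : IsIdeal H) (hK : IsIdeal K) :
    IsIdeal (H ⊓ K) :=
  fun x w hw => ⟨⟨(hH x w hw.1).1, (hK x w hw.2).1⟩, ⟨(hH x w hw.1).2, (hK x w hw.2).2⟩⟩

/-! ### Multiplication operators on the filtration. -/

namespace IsNullFiliform

variable {E : ℕ → L}

theorem mul_eq_zero [SMulCommClass F L L] (hE : IsNullFiliform E) (i : ℕ) {w : L}
    (hw : w ∈ tail F E 1) : E i * w = 0 := by
  have := mul_mem_of_mem_tail' (P := (⊥ : Submodule F L)) (y := E i) (fun j hj => by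
    obtain ⟨j, rfl⟩ := Nat.exists_eq_add_of_le' hj
    simp [hE.mul_succ]) hw
  simpa using this

theorem mul_zero_mem [IsScalarTower F L L] (hE : IsNullFiliform E) {k : ℕ} {w : L}
    (hw : w ∈ tail F E k) : w * E 0 ∈ tail F E (k + 1) :=
  mul_mem_of_mem_tail (fun i hi => by rw [hE.mul_zero]; exact mem_tail E (by omega)) hw

/-- The elements whose right multiplication strictly raises the filtration by tails. -/
def raising (F : Type*) {L : Type*} [Field F] [NonUnitalNonAssocRing L] [Module F L]
    [SMulCommClass F L L] (E : ℕ → L) : Submodule F L :=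
  (tail F E 1).comap (LinearMap.mulLeft F (E 0))

theorem tail_le_raising [SMulCommClass F L L] (hE : IsNullFiliform E) :
    tail F E 0 ≤ raising F E := by
  refine tail_le fun i _ => ?_
  change E 0 * E i ∈ tail F E 1
  cases i with
  | zero => rw [hE.mul_zero]; exact mem_tail E le_rfl
  | succ i => rw [hE.mul_succ]; exact zero_mem _

/-- A unitriangular change of sequence is inverted by descending induction on `k`, starting where
the tail vanishes. -/
theorem tail_le_tail_of_sub_mem {E' : ℕ → L} {n : ℕ} (hn : ∀ i, n ≤ i → E i = 0)
    (h : ∀ i, E' i - E i ∈ tail F E (i + 1)) (k : ℕ) : tail F E k ≤ tail F E' k := by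
  by_cases hk : n ≤ k
  · rw [tail_eq_bot (fun i hi => hn i (hk.trans hi))]
    exact bot_le
  · have ih := (tail_le_tail_of_sub_mem hn h (k + 1)).trans (tail_anti E' (Nat.le_succ k))
    refine tail_le fun i hi => ?_
    rcases hi.eq_or_lt with rfl | hi
    · exact (Submodule.sub_mem_iff_right _ (mem_tail E' le_rfl)).mp (ih (h k))
    · exact ih (mem_tail E hi)
termination_by n - k

theorem mul_eq_smul [SMulCommClass F L L] (hE : IsNullFiliform E) (i : ℕ) {w : L} {c : F}
    (hw : w - c • E 0 ∈ tail F E 1) : E i * w = c • E (i + 1) := by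
  have := hE.mul_eq_zero i hw
  rwa [mul_sub, sub_eq_zero, mul_smul_comm, hE.mul_zero] at this

/-- The null-filiform sequence generated by `u`. -/
def powers (u : L) : ℕ → L
  | 0 => u
  | i + 1 => powers u i * u

/-- Since `u - E 0` lies in the first tail, which annihilates the span of `E` from the right, `u`
and `E 0` act there by the same right multiplication. -/
theorem powers_sub_mem [IsScalarTower F L L] [SMulCommClass F L L] (hE : IsNullFiliform E) {u : L}
    (hu : u - E 0 ∈ tail F E 1) (i : ℕ) :
    powers u i - E i ∈ tail F E (i + 1) := by
  induction i with
  | zero => exact hu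
  | succ i ih =>
    have hle : ∀ w ∈ tail F E 0, w * (u - E 0) = 0 := fun w hw => by
      have := mul_mem_of_mem_tail (P := (⊥ : Submodule F L)) (y := u - E 0)
        (fun j _ => by simp [hE.mul_eq_zero j hu]) hw
      simpa using this
    have h1 : powers u i ∈ tail F E 0 :=
      (Submodule.sub_mem_iff_left _ (mem_tail E (Nat.zero_le i))).mp (tail_anti E (Nat.zero_le _) ih)
    have h2 := hle _ h1
    have h3 := hE.mul_zero_mem ih
    rw [mul_sub, sub_eq_zero] at h2
    rw [sub_mul, hE.mul_zero, ← h2] at h3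
    exact h3

/-- By the Leibniz identity `E 0 * (y * z)` is antisymmetric in `y` and `z`. Taking `y = p`, `z = E
0` forces the leading coefficients of `p * E 0` and `E 0 * p` to be opposite. -/
theorem left_mul_add_mem [SMulCommClass F L L] [IsLeibniz L] (hE : IsNullFiliform E)
    (hne : E 1 ≠ 0) {p : L} {a : F} (hp : p * E 0 ∈ tail F E 0)
    (ha : E 0 * p - a • E 0 ∈ tail F E 1) :
    p * E 0 + a • E 0 ∈ tail F E 1 := by
  obtain ⟨b, hb⟩ := exists_sub_mem_tail_succ E hp
  have h1 := hE.mul_eq_smul 0 ha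
  have h2 := hE.mul_eq_smul 0 hb
  rw [IsLeibniz.leibniz] at h1 h2
  have h3 : (a + b) • E 1 = 0 := by
    rw [zero_add] at h1 h2
    rw [add_smul, ← h1, ← h2]; abel
  have h4 : b = -a := by
    rcases smul_eq_zero.mp h3 with h | h
    · exact eq_neg_of_add_eq_zero_right h
    · exact absurd h hne
  rw [h4] at hb
  simpa using hb

variable [IsScalarTower F L L] [SMulCommClass F L L] [IsLeibniz L]

/-- Right multiplication by `p` is triangular, with diagonal determined by its action on `E 0`. -/
theorem mul_sub_mem (hE : IsNullFiliform E) {p : L} {a : F}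
    (ha : E 0 * p - a • E 0 ∈ tail F E 1) (i : ℕ) :
    E i * p - (((i : F) + 1) * a) • E i ∈ tail F E (i + 1) := by
  induction i with
  | zero => simpa using ha
  | succ i ih =>
    have h := hE.mul_zero_mem ih
    rw [sub_mul, smul_mul_assoc, hE.mul_zero] at h
    convert h using 1
    -- Derivation rule on `E i * E 0`: the factor `E 0` contributes `a`, the factor `E i`
    -- contributes `(i + 1) * a`.
    rw [← hE.mul_zero i, IsLeibniz.mul_mul_right, hE.mul_eq_smul i ha, hE.mul_zero]
    push_cast
    module

theorem mul_mem_tail (hE : IsNullFiliform E) {p : L} {a : F}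
    (ha : E 0 * p - a • E 0 ∈ tail F E 1) {k : ℕ} {w : L} (hw : w ∈ tail F E k) :
    w * p ∈ tail F E k :=
  mul_mem_of_mem_tail (fun i hi => by
    have h := tail_anti (F := F) E (show k ≤ i + 1 by omega) (hE.mul_sub_mem ha i)
    exact (Submodule.sub_mem_iff_left _ (Submodule.smul_mem _ _ (mem_tail E hi))).mp h) hw

theorem mul_mem_tail_succ (hE : IsNullFiliform E) {p : L}
    (ha : E 0 * p ∈ tail F E 1) {k : ℕ} {w : L} (hw : w ∈ tail F E k) :
    w * p ∈ tail F E (k + 1) :=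
  mul_mem_of_mem_tail (fun i hi => by
    have h := hE.mul_sub_mem (F := F) (p := p) (a := 0) (by simpa using ha) i
    rw [MulZeroClass.mul_zero, zero_smul, sub_zero] at h
    exact tail_anti E (Nat.succ_le_succ hi) h) hw

/-- The Leibniz identity kills `p * (y * y)`, in particular `p * E 1`; the later terms follow
because `E (i + 2) = E (i + 1) * E 0` and `E (i + 1)` annihilates `p * E 0` from the right. -/
theorem left_mul_eq_zero (hE : IsNullFiliform E) {p : L} (hp : p * E 0 ∈ tail F E 0) {w : L}
    (hw : w ∈ tail F E 1) : p * w = 0 := by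
  have key : ∀ i, p * E (i + 1) = 0 := by
    intro i
    induction i with
    | zero => rw [← hE.mul_zero 0, IsLeibniz.leibniz, sub_self]
    | succ i ih =>
      have := mul_mem_of_mem_tail (P := (⊥ : Submodule F L)) (y := E (i + 1))
        (fun j _ => by simp [hE.mul_succ]) hp
      rw [← hE.mul_zero (i + 1), IsLeibniz.leibniz, ih, zero_mul, zero_sub, neg_eq_zero]
      simpa using this
  have := mul_mem_of_mem_tail' (P := (⊥ : Submodule F L)) (y := p) (fun j hj => by
    obtain ⟨j, rfl⟩ := Nat.exists_eq_add_of_le' hj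
    simp [key]) hw
  simpa using this

/-! ### Identifying the nilradical with `raising`. -/

/-- Right multiplication by `p * q` is a commutator of two triangular operators, so its diagonal
vanishes. -/
theorem mul_mem_raising (hE : IsNullFiliform E) (hI : IsIdeal (tail F E 0)) (p q : L) :
    p * q ∈ raising F E := by
  have h0 := mem_tail (F := F) E (le_refl 0)
  obtain ⟨a, ha⟩ := exists_sub_mem_tail_succ E (hI p _ h0).2
  obtain ⟨b, hb⟩ := exists_sub_mem_tail_succ E (hI q _ h0).2
  change E 0 * (p * q) ∈ tail F E 1
  have h1 := hE.mul_mem_tail hb ha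
  have h2 := hE.mul_mem_tail ha hb
  rw [sub_mul, smul_mul_assoc] at h1 h2
  have h3 := add_mem (sub_mem h1 h2)
    (sub_mem (Submodule.smul_mem _ a hb) (Submodule.smul_mem _ b ha))
  convert h3 using 1
  rw [IsLeibniz.leibniz]
  module

theorem isIdeal_raising (hE : IsNullFiliform E) (hI : IsIdeal (tail F E 0)) :
    IsIdeal (raising F E) :=
  fun _ _ _ => ⟨hE.mul_mem_raising hI _ _, hE.mul_mem_raising hI _ _⟩

/-- One product lands in the span of `E`; each further product with `P`, on either side, moves one
step down the filtration. On the left this holds because `P` kills the first tail and, by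
`left_mul_add_mem` with `a = 0`, sends `E 0` into it. -/
theorem isNilpotent_of_le_raising (hE : IsNullFiliform E) (hne : E 1 ≠ 0)
    (hI : IsIdeal (tail F E 0)) {n : ℕ} (hn : ∀ i, n ≤ i → E i = 0) {P : Submodule F L}
    (hP : P ≤ raising F E) (hPP : ∀ x ∈ P, ∀ y ∈ P, x * y ∈ tail F E 0) : IsNilpotent P := by
  have key : ∀ k, lowerCentral P (k + 1) ≤ tail F E k := by
    intro k
    induction k with
    | zero => exact commutator_le fun x hx y hy => ⟨hPP x hx y hy, hPP y hy x hx⟩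
    | succ k ih =>
      refine commutator_le fun x hx y hy => ⟨hE.mul_mem_tail_succ (hP hy) (ih hx), ?_⟩
      have hy0 := (hI y _ (mem_tail E le_rfl)).1
      have hy1 := hE.left_mul_add_mem (a := (0 : F)) hne hy0
        (by rw [zero_smul, sub_zero]; exact hP hy)
      rw [zero_smul, add_zero] at hy1
      refine mul_mem_of_mem_tail' (k := k) (fun i hi => ?_) (ih hx)
      cases i with
      | zero => obtain rfl : k = 0 := by omega
                exact hy1
      | succ i => rw [hE.left_mul_eq_zero hy0 (mem_tail E (by omega))]; exact zero_mem _
  exact ⟨n + 1, le_bot_iff.mp ((key n).trans (tail_eq_bot hn).le)⟩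

theorem raising_eq (hE : IsNullFiliform E) (hne : E 1 ≠ 0) {n : ℕ} (hn : ∀ i, n ≤ i → E i = 0)
    (hsol : IsSolvable (⊤ : Submodule F L)) (hN : IsNilradical (tail F E 0)) :
    raising F E = tail F E 0 := by
  have hI := hN.prop.1
  have key : ∀ s, raising F E ⊓ derived ⊤ (s + 1) ≤ tail F E 0 →
      raising F E ⊓ derived ⊤ s ≤ tail F E 0 := by
    intro s hs
    -- Products of two elements of `raising F E ⊓ derived ⊤ s` lie in the next intersection, already
    -- inside the nilradical; so this sum is a nilpotent ideal and maximality applies.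
    refine le_sup_left.trans (hN.le_of_ge (y := raising F E ⊓ derived ⊤ s ⊔ tail F E 0)
      ⟨((hE.isIdeal_raising hI).inf (isIdeal_derived_top s)).sup hI, ?_⟩ le_sup_right)
    refine hE.isNilpotent_of_le_raising hne hI hn (sup_le inf_le_left hE.tail_le_raising) ?_
    intro x hx y hy
    obtain ⟨x, hxs, x', hx', rfl⟩ := Submodule.mem_sup.mp hx
    obtain ⟨y, hys, y', hy', rfl⟩ := Submodule.mem_sup.mp hy
    rw [add_mul, mul_add]
    exact add_mem (add_mem (hs ⟨hE.mul_mem_raising hI _ _, mul_mem_commutator hxs.2 hys.2⟩)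
      (hI x _ hy').1) (hI _ _ hx').2
  obtain ⟨s, hs⟩ := hsol
  have h0 : ∀ t, raising F E ⊓ derived ⊤ t ≤ tail F E 0 → raising F E ≤ tail F E 0 := by
    intro t
    induction t with
    | zero => exact fun h => (le_inf le_rfl le_top).trans h
    | succ t ih => exact fun h => ih (key t h)
  exact le_antisymm (h0 s (by simp [hs])) hE.tail_le_raising

/-! ### The complement of the nilradical. -/

/-- The diagonal entries `(k + 1) * a` are nonzero in characteristic zero, so the triangular system
is solved one coefficient at a time. -/
theorem exists_mul_eq [CharZero F] (hE : IsNullFiliform E) {n : ℕ} (hn : ∀ i, n ≤ i → E i = 0)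
    {p : L} {a : F} (ha0 : a ≠ 0) (ha : E 0 * p - a • E 0 ∈ tail F E 1) (k : ℕ) {w : L}
    (hw : w ∈ tail F E k) : ∃ z ∈ tail F E k, z * p = w := by
  by_cases hk : n ≤ k
  · have := tail_anti E hk hw
    rw [tail_eq_bot hn, Submodule.mem_bot] at this
    exact ⟨0, zero_mem _, by rw [zero_mul, this]⟩
  · obtain ⟨c, hc⟩ := exists_sub_mem_tail_succ E hw
    have hd : ((k : F) + 1) * a ≠ 0 := mul_ne_zero (Nat.cast_add_one_ne_zero k) ha0
    set d : F := ((k : F) + 1) * a with hd'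
    have h := Submodule.smul_mem _ (c / d) (hE.mul_sub_mem ha k)
    rw [← hd', smul_sub, smul_smul, div_mul_cancel₀ c hd] at h
    obtain ⟨z, hz, hzp⟩ := hE.exists_mul_eq hn ha0 ha (k + 1) (sub_mem hc h)
    refine ⟨z + (c / d) • E k, add_mem (tail_anti E (Nat.le_succ k) hz)
      (Submodule.smul_mem _ _ (mem_tail E le_rfl)), ?_⟩
    rw [add_mul, hzp, smul_mul_assoc]
    abel
termination_by n - k

/-- There is a complement of the nilradical spanned by an element of square zero. -/
theorem exists_sq_zero [CharZero F] (hE : IsNullFiliform E) (hne : E 1 ≠ 0) {n : ℕ}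
    (hn : ∀ i, n ≤ i → E i = 0) (hI : IsIdeal (tail F E 0))
    (hr : raising F E = tail F E 0) (hN : tail F E 0 ≠ ⊤) :
    ∃ x : L, E 0 * x + E 0 ∈ tail F E 1 ∧ x * E 0 - E 0 ∈ tail F E 1 ∧ x * x = 0 ∧
      x ∉ tail F E 0 ∧ ∀ y, ∃ c : F, y + c • x ∈ tail F E 0 := by
  have h0 := mem_tail (F := F) E (le_refl 0)
  obtain ⟨y, hy⟩ : ∃ y, y ∉ tail F E 0 := by
    by_contra! h
    exact hN (eq_top_iff.mpr fun y _ => h y)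
  obtain ⟨a, ha⟩ := exists_sub_mem_tail_succ E (hI y _ h0).2
  have ha0 : a ≠ 0 := by
    rintro rfl
    rw [zero_smul, sub_zero] at ha
    exact hy (hr ▸ ha)
  obtain ⟨x, hx⟩ : ∃ x, E 0 * x - (-1 : F) • E 0 ∈ tail F E 1 := by
    refine ⟨(-a⁻¹) • y, ?_⟩
    have h := Submodule.smul_mem _ (-a⁻¹) ha
    rw [smul_sub, smul_smul, neg_mul, inv_mul_cancel₀ ha0] at h
    rwa [mul_smul_comm]
  have hl := hE.left_mul_add_mem hne (hI x _ h0).1 hx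
  have hxx : x * x ∈ tail F E 1 := by
    have h1 : x * x ∈ tail F E 0 := hr ▸ hE.mul_mem_raising hI x x
    obtain ⟨c, hc⟩ := exists_sub_mem_tail_succ E h1
    -- As `x * (x * x) = 0`, this gives `c • (x * E 0) = 0`; and `x * E 0 = 0` would put `E 0` in
    -- the first tail, forcing `E 1 = 0`.
    have h2 := hE.left_mul_eq_zero (hI x _ h0).1 hc
    rw [mul_sub, IsLeibniz.leibniz x x x, sub_self, zero_sub, neg_eq_zero, mul_smul_comm] at h2
    rcases smul_eq_zero.mp h2 with rfl | h2
    · simpa using hc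
    · rw [h2, zero_add] at hl
      have h3 := hE.mul_eq_zero 0 hl
      rw [mul_smul_comm, hE.mul_zero, neg_one_smul, neg_eq_zero] at h3
      exact absurd h3 hne
  -- Since `x * z = z * z = 0`, the square of `x - z` is `x * x - z * x = 0`.
  obtain ⟨z, hz, hzx⟩ := hE.exists_mul_eq hn (neg_ne_zero.mpr one_ne_zero) hx 1 hxx
  have hEz : E 0 * (x - z) = E 0 * x := by rw [mul_sub, hE.mul_eq_zero 0 hz, sub_zero]
  have hz0 := tail_anti E (Nat.zero_le 1) hz
  have hx' : E 0 * (x - z) + E 0 ∈ tail F E 1 := by rw [hEz]; simpa using hx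
  refine ⟨x - z, hx', ?_, ?_, ?_, ?_⟩
  · have h := hE.mul_zero_mem hz
    rw [sub_mul]
    have h' := sub_mem hl (tail_anti E (Nat.le_succ 1) h)
    convert h' using 1
    module
  · have h1 : x * z = 0 := hE.left_mul_eq_zero (hI x _ h0).1 hz
    have h2 : z * z = 0 := hE.left_mul_eq_zero (hI z _ h0).1 hz
    rw [sub_mul, mul_sub, mul_sub, h1, h2, hzx]
    abel
  · intro h
    have h1 : E 0 * (x - z) ∈ tail F E 1 := hE.tail_le_raising h
    have h2 : E 0 ∈ tail F E 1 := (add_mem_cancel_left h1).mp hx'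
    have h3 := hE.mul_eq_zero 0 h2
    rw [hE.mul_zero] at h3
    exact hne h3
  · intro u
    obtain ⟨c, hc⟩ := exists_sub_mem_tail_succ E (hI u _ h0).2
    -- The diagonal coefficients of `u` and `x - z` are `c` and `-1`, so the combination has
    -- coefficient zero.
    refine ⟨c, hr ▸ ?_⟩
    change E 0 * (u + c • (x - z)) ∈ tail F E 1
    have h := add_mem hc (Submodule.smul_mem _ c hx')
    rw [mul_add, mul_smul_comm]
    convert h using 1
    module

end IsNullFiliform

end

/-! ### Assembling the basis and comparing tables. -/

open IsNullFiliform in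
theorem exists_basis_hasRTable {F : Type*} [Field F] [CharZero F] {n : ℕ} (hn : 2 ≤ n)
    {R : Type*} [NonUnitalNonAssocRing R] [Module F R] [IsScalarTower F R R]
    [SMulCommClass F R R] [IsLeibniz R]
    (hsol : IsSolvable (⊤ : Submodule F R)) (hnil : ¬ IsNilpotent (⊤ : Submodule F R))
    {N : Submodule F R} (hN : IsNilradical N) (hNF : IsNF n N) :
    ∃ b : Module.Basis (Fin n ⊕ Unit) F R,
      HasRTable F (fun i => b (Sum.inl i)) (b (Sum.inr ())) := by
  obtain ⟨e, he⟩ := hNF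
  -- Extension by zero makes `E i * E 0 = E (i + 1)` hold at the last index too.
  set E : ℕ → R := fun i => if h : i < n then (e ⟨i, h⟩ : R) else 0 with hEdef
  have hEn : ∀ i, n ≤ i → E i = 0 := fun i hi => dif_neg (by omega)
  have hElt : ∀ i (h : i < n), E i = e ⟨i, h⟩ := fun i h => dif_pos h
  have hE0 : ∀ i, i < n → E i ≠ 0 := fun i h => by
    rw [hElt i h]
    exact fun h0 => e.ne_zero _ (Subtype.ext h0)
  have hE : IsNullFiliform E := by
    constructor
    · intro i
      by_cases hi : i < n
      · rw [hElt i hi, hElt 0 (by omega), he ⟨i, hi⟩ ⟨0, _⟩]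
        simp [hEdef]
      · rw [hEn i (by omega), hEn (i + 1) (by omega), zero_mul]
    · intro i j
      by_cases hi : i < n
      · by_cases hj : j + 1 < n
        · rw [hElt i hi, hElt _ hj, he ⟨i, hi⟩ ⟨j + 1, hj⟩]
          simp
        · rw [hEn (j + 1) (by omega), MulZeroClass.mul_zero]
      · rw [hEn i (by omega), zero_mul]
  have hNE : N = tail F E 0 := by
    apply le_antisymm
    · intro w hw
      have h := e.sum_repr ⟨w, hw⟩
      have h' := congrArg N.subtype h
      rw [map_sum] at h'
      rw [show w = N.subtype ⟨w, hw⟩ from rfl, ← h']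
      refine Submodule.sum_mem _ fun i _ => ?_
      rw [map_smul]
      refine Submodule.smul_mem _ _ ?_
      have h1 := mem_tail (F := F) E (Nat.zero_le i)
      rwa [hElt i i.2] at h1
    · refine tail_le fun i _ => ?_
      by_cases hi : i < n
      · rw [hElt i hi]; exact (e _).2
      · rw [hEn i (by omega)]; exact zero_mem _
  rw [hNE] at hN
  have hI := hN.prop.1
  have hne : E 1 ≠ 0 := hE0 1 (by omega)
  obtain ⟨x, hEx, hxE, hxx, hxN, hspan⟩ := hE.exists_sq_zero hne hEn hI
    (hE.raising_eq hne hEn hsol hN) (fun h => hnil (h ▸ hN.prop.2))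
  -- `u` differs from `E 0` by an element of the first tail, which `x` kills from the left; hence `x
  -- * u = x * E 0 = u`.
  set u := x * E 0 with hu
  set E' := powers u with hE'
  have hsub := hE.powers_sub_mem hxE
  have hE'n : ∀ i, n ≤ i → E' i = 0 := fun i hi => by
    have h := hsub i
    rw [hEn i hi, sub_zero] at h
    have h1 := tail_anti E (show n ≤ i + 1 by omega) h
    rwa [tail_eq_bot hEn, Submodule.mem_bot] at h1
  have hx0 : ∀ w ∈ tail F E 1, x * w = 0 := fun w hw =>
    hE.left_mul_eq_zero (hI x _ (mem_tail E le_rfl)).1 hw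
  have hE'mem : ∀ i, E' i ∈ tail F E i := fun i =>
    (Submodule.sub_mem_iff_left _ (mem_tail E le_rfl)).mp (tail_anti E (Nat.le_succ i) (hsub i))
  have hxu : x * u = u := by
    have h := hx0 _ hxE
    rwa [mul_sub, sub_eq_zero] at h
  have hux : u * x = -u := by
    -- Expanded by the Leibniz identity with `x * x = 0` and `x * u = u`, this reads `u * x + u =
    -- 0`.
    have h1 : x * (u * x + E 0) = 0 := by
      refine hx0 _ ?_
      have h2 := hE.mul_mem_tail (a := (-1 : F)) (p := x) (by simpa using hEx) hxE
      rw [sub_mul] at h2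
      have h3 := add_mem h2 hEx
      convert h3 using 1
      abel
    rw [mul_add, IsLeibniz.leibniz, hxu, hxx, zero_mul, sub_zero] at h1
    exact eq_neg_of_add_eq_zero_left h1
  have hE'x : ∀ i, E' i * x = -((i : F) + 1) • E' i := by
    intro i
    induction i with
    | zero => simpa [hE', powers] using hux
    | succ i ih =>
      change E' i * u * x = -(((i + 1 : ℕ) : F) + 1) • (E' i * u)
      rw [IsLeibniz.mul_mul_right, hux, ih, smul_mul_assoc, mul_neg]
      push_cast
      module
  have hE'ne : ∀ i, i < n → E' i ≠ 0 := by
    -- The difference `E' (n - 1) - E (n - 1)` lies in the zero tail. An earlier vanishing term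
    -- would make this one vanish as well.
    have hlast : E' (n - 1) ≠ 0 := by
      have h := hsub (n - 1)
      rw [Nat.sub_add_cancel (by omega), tail_eq_bot hEn, Submodule.mem_bot, sub_eq_zero] at h
      rw [hE', h]
      exact hE0 _ (by omega)
    have hstep : ∀ k i, E' i = 0 → E' (i + k) = 0 := by
      intro k i h
      induction k with
      | zero => exact h
      | succ k ih => change E' (i + k) * u = 0; rw [ih, zero_mul]
    intro i hi h
    apply hlast
    have := hstep (n - 1 - i) i h
    rwa [show i + (n - 1 - i) = n - 1 by omega] at this
  have hE'E' : ∀ i j, E' i * E' (j + 1) = 0 := by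
    intro i j
    have h := mul_mem_of_mem_tail (P := (⊥ : Submodule F R)) (y := E' (j + 1)) (fun k _ => by
      rw [hE.mul_eq_zero k (tail_anti E (by omega) (hE'mem (j + 1)))]; exact zero_mem _) (hE'mem i)
    simpa using h
  let v : Fin n ⊕ Unit → R := Sum.elim (fun i => E' i) (fun _ => x)
  -- Eigenvalues of right multiplication by `x`, with `0` for `x` itself; they are distinct in
  -- characteristic zero, which gives linear independence.
  let μ : Fin n ⊕ Unit → F := Sum.elim (fun i => -(((i : ℕ) : F) + 1)) (fun _ => 0)
  have hμ : Function.Injective μ := by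
    rintro (i | i) (j | j) h
    · simp only [μ, Sum.elim_inl, neg_inj, add_left_inj, Nat.cast_inj] at h
      rw [Fin.ext h]
    · simp only [μ, Sum.elim_inl, Sum.elim_inr, neg_eq_zero] at h
      exact absurd h (Nat.cast_add_one_ne_zero _)
    · simp only [μ, Sum.elim_inl, Sum.elim_inr, zero_eq_neg] at h
      exact absurd h (Nat.cast_add_one_ne_zero _)
    · rfl
  have hli : LinearIndependent F v := by
    refine Module.End.eigenvectors_linearIndependent' (LinearMap.mulRight F x) μ hμ v ?_
    rintro (i | i)
    · exact Module.End.hasEigenvector_iff.mpr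
        ⟨Module.End.mem_eigenspace_iff.mpr (hE'x i), hE'ne i i.2⟩
    · refine Module.End.hasEigenvector_iff.mpr ⟨Module.End.mem_eigenspace_iff.mpr ?_, ?_⟩
      · simpa [v, μ] using hxx
      · rintro h
        exact hxN ((show x = 0 from h) ▸ zero_mem _)
  have hsp : ⊤ ≤ Submodule.span F (Set.range v) := by
    intro y _
    have h1 : tail F E 0 ≤ Submodule.span F (Set.range v) := by
      refine (tail_le_tail_of_sub_mem hEn hsub 0).trans (tail_le fun i _ => ?_)
      by_cases hi : i < n
      · exact Submodule.subset_span ⟨Sum.inl ⟨i, hi⟩, rfl⟩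
      · change E' i ∈ _
        rw [hE'n i (by omega)]; exact zero_mem _
    obtain ⟨c, hc⟩ := hspan y
    exact (add_mem_cancel_right (Submodule.smul_mem _ c
      (Submodule.subset_span (Set.mem_range_self (f := v) (Sum.inr ()))))).mp (h1 hc)
  refine ⟨Module.Basis.mk hli hsp, ?_, ?_, ?_, ?_⟩ <;>
    simp only [Module.Basis.mk_apply, v, Sum.elim_inl, Sum.elim_inr]
  · rintro i ⟨j, hj⟩
    cases j with
    | succ j => simp [hE'E']
    | zero =>
      change E' (i + 1) = _
      split_ifs with h
      · rfl
      · exact hE'n _ (by simpa using h)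
  · rintro ⟨j, hj⟩
    cases j with
    | succ j => simpa using hx0 _ (tail_anti E (by omega) (hE'mem (j + 1)))
    | zero => simpa [hE', powers] using hxu
  · exact fun i => hE'x i
  · exact hxx

/-- Algebras with bases that have the same multiplication table are isomorphic. -/
theorem HasRTable.exists_equiv {F : Type*} [Field F] {n : ℕ}
    {R : Type*} [NonUnitalNonAssocRing R] [Module F R] [IsScalarTower F R R] [SMulCommClass F R R]
    {S : Type*} [NonUnitalNonAssocRing S] [Module F S] [IsScalarTower F S S] [SMulCommClass F S S]
    {b : Module.Basis (Fin n ⊕ Unit) F R} {c : Module.Basis (Fin n ⊕ Unit) F S}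
    (hb : HasRTable F (fun i => b (Sum.inl i)) (b (Sum.inr ())))
    (hc : HasRTable F (fun i => c (Sum.inl i)) (c (Sum.inr ()))) :
    ∃ f : R ≃ₗ[F] S, ∀ x y : R, f (x * y) = f x * f y := by
  let f : R ≃ₗ[F] S := b.equiv c (Equiv.refl _)
  have hf : ∀ i, f (b i) = c i := fun i => b.equiv_apply i c (Equiv.refl _)
  have key : (LinearMap.mul F R).compr₂ f.toLinearMap =
      (LinearMap.mul F S).compl₁₂ f.toLinearMap f.toLinearMap := by
    refine b.ext fun i => b.ext fun j => ?_
    change f (b i * b j) = f (b i) * f (b j)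
    rw [hf, hf]
    rcases i with i | i <;> rcases j with j | j
    · have h1 := hb.e_mul_e i j
      have h2 := hc.e_mul_e i j
      beta_reduce at h1 h2
      rw [h1, h2]
      split_ifs
      · exact hf _
      · exact map_zero f
    · have h1 := hb.e_mul_x i
      have h2 := hc.e_mul_x i
      beta_reduce at h1 h2
      rw [h1, h2, map_smul, hf]
    · have h1 := hb.x_mul_e j
      have h2 := hc.x_mul_e j
      beta_reduce at h1 h2
      rw [h1, h2]
      split_ifs
      · exact hf _
      · exact map_zero f
    · rw [hb.x_mul_x, hc.x_mul_x, map_zero]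
  exact ⟨f, fun x y => LinearMap.congr_fun₂ key x y⟩

end Leibniz

theorem theorem3p5 {F : Type*} [Field F] [CharZero F] (n : ℕ) (hn : 2 ≤ n)
    {R : Type*} [NonUnitalNonAssocRing R] [Module F R] [IsScalarTower F R R]
    [SMulCommClass F R R] [Leibniz.IsLeibniz R] [FiniteDimensional F R]
    (hsol : Leibniz.IsSolvable (⊤ : Submodule F R))
    (hnil : ¬ Leibniz.IsNilpotent (⊤ : Submodule F R))
    (N : Submodule F R) (hN : Leibniz.IsNilradical N) (hNF : Leibniz.IsNF n N) :
    (∃ b : Module.Basis (Fin n ⊕ Unit) F R,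
      Leibniz.HasRTable F (fun i => b (Sum.inl i)) (b (Sum.inr ()))) ∧
    ∀ (S : Type*) [NonUnitalNonAssocRing S] [Module F S] [IsScalarTower F S S]
      [SMulCommClass F S S] [Leibniz.IsLeibniz S] [FiniteDimensional F S],
      Leibniz.IsSolvable (⊤ : Submodule F S) →
      ¬ Leibniz.IsNilpotent (⊤ : Submodule F S) →
      (∃ M : Submodule F S, Leibniz.IsNilradical M ∧ Leibniz.IsNF n M) →
      ∃ f : R ≃ₗ[F] S, ∀ x y : R, f (x * y) = f x * f y := by
  obtain ⟨b, hb⟩ := Leibniz.exists_basis_hasRTable hn hsol hnil hN hNF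
  refine ⟨⟨b, hb⟩, ?_⟩
  intro S _ _ _ _ _ _ hsolS hnilS ⟨M, hM, hMF⟩
  obtain ⟨c, hc⟩ := Leibniz.exists_basis_hasRTable hn hsolS hnilS hM hMF
  exact hb.exists_equiv hc
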